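/- **Theorem 1.4.** Let $n\ge 0$ and let $C,D\subseteq\mathbb{F}_2^n$ be doubly-even binary (linear) codes, i.e. subspaces all of whose elements have weight divisible by $4$. Let $\alpha_1,\dots,\alpha_n$ be an orthogonal basis of Euclidean space $\mathbb{R}^n$ with $(\alpha_i,\alpha_i)=2$, put $\alpha_c=\sum_i c_i\alpha_i$ for $c\in\mathbb{F}_2^n$ (with $c_i$ read in $\{0,1\}\subset\mathbb{Z}$), and define the lattices $$\mathcal{L}(D)=\sum_{i}\mathbb{Z}\alpha_i+\sum_{c\in D}\mathbb{Z}\tfrac12\alpha_c,\qquad \mathcal{L}^+(C)=\sum_{i,j}\mathbb{Z}(\alpha_i+\alpha_j)+\sum_{c\in C}\mathbb{Z}\tfrac12\alpha_c .$$ A Kleinian code $K$ of length $m$ is a subgroup of $\mathbb{K}^m$, where $\mathbb{K}=\{0,a,b,c\}$ is the Klein four group; it is even if every element of $K$ has an even number of nonzero coordinates. Let $\hat{\ }:\mathbb{K}^m\to\mathbb{F}_2^{4m}$ be the coordinatewise map induced by $0\mapsto 0000$, $a\mapsto 1100$, $b\mapsto 1010$, $c\mapsto 0110$, let $d_4^m=\{0000,1111\}^m$,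 let $(d_4^m)_0$ be the subcode of vectors in $d_4^m$ of weight divisible by $8$, and put $\mathcal{C}(K)=\hat K+d_4^m$ and $\mathcal{C}^+(K)=\hat K+(d_4^m)_0$, binary codes of length $4m$. Then $\mathcal{L}^+(C)$ and $\mathcal{L}(D)$ are isomorphic (one is carried onto the other by an orthogonal transformation of $\mathbb{R}^n$) if and only if there exist an integer $m\ge 0$ with $n=4m$ and an even Kleinian code $K$ of length $m$ such that $C$ is equivalent to $\mathcal{C}(K)$ and $D$ is equivalent to $\mathcal{C}^+(K)$, where two binary codes are equivalent if one is obtained from the other by a permutation of the coordinates. -/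

import Mathlib

/-! Binary codes. A code is indexed by a finite set of coordinates `ι` (its length is the
cardinality of `ι`); codes of length `n` are obtained for `ι = Fin n`. -/

/-- A binary linear code with coordinate set `ι`: a subspace of `𝔽₂^ι`. -/
abbrev BinaryCode (ι : Type) : Type := Submodule (ZMod 2) (ι → ZMod 2)

/-- Every codeword has weight divisible by `4`. -/
def BinaryCode.IsDoublyEven {ι : Type} [Fintype ι] (C : BinaryCode ι) : Prop :=
  ∀ x ∈ C, 4 ∣ hammingNorm x

/-- Equivalence of binary codes: one is carried to the other by a relabelling (for `ι = κ`,
a permutation) of the coordinates. In particular equivalent codes have the same length. -/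
def BinaryCode.IsEquivalent {ι κ : Type} (C : BinaryCode ι) (D : BinaryCode κ) : Prop :=
  ∃ σ : ι ≃ κ, ∀ x : κ → ZMod 2, x ∈ D ↔ x ∘ σ ∈ C

/-! Kleinian codes. -/

/-- The Klein four group, with `a = (1, 0)`, `b = (0, 1)` and `c = (1, 1)`. -/
abbrev Klein : Type := ZMod 2 × ZMod 2

/-- A Kleinian code of length `m`: a subgroup of the `m`-th power of the Klein four group. -/
abbrev KleinianCode (m : ℕ) : Type := AddSubgroup (Fin m → Klein)

/-- Every codeword has even weight, the weight being the number of nonzero coordinates. -/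
def KleinianCode.IsEven {m : ℕ} (K : KleinianCode m) : Prop :=
  ∀ k ∈ K, 2 ∣ hammingNorm k

/-- The map `𝕂 → 𝔽₂⁴`, `0 ↦ 0000`, `a ↦ 1100`, `b ↦ 1010`, `c ↦ 0110`. -/
def kleinHat (k : Klein) : Fin 4 → ZMod 2 := ![k.1 + k.2, k.1, k.2, 0]

theorem kleinHat_values :
    kleinHat (0, 0) = ![0, 0, 0, 0] ∧ kleinHat (1, 0) = ![1, 1, 0, 0] ∧
    kleinHat (0, 1) = ![1, 0, 1, 0] ∧ kleinHat (1, 1) = ![0, 1, 1, 0] := by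
  decide

theorem kleinHat_add : ∀ k l : Klein, kleinHat (k + l) = kleinHat k + kleinHat l := by
  decide

/-- The induced homomorphism `𝕂^m → 𝔽₂^{4m}`. The `4m` coordinates are grouped into `m` blocks
of length `4`: the coordinate `(i, j)` is the `j`-th one of the `i`-th block. -/
def kleinHatHom (m : ℕ) : (Fin m → Klein) →+ (Fin m × Fin 4 → ZMod 2) where
  toFun k := fun p => kleinHat (k p.1) p.2
  map_zero' := by
    funext p
    have h : ∀ j : Fin 4, kleinHat 0 j = 0 := by decide
    exact h p.2
  map_add' k l := by
    funext p
    exact congrFun (kleinHat_add (k p.1) (l p.1)) p.2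

/-- The code `{0000, 1111}^m`, i.e. the vectors that are constant on each block. -/
def d4Pow (m : ℕ) : BinaryCode (Fin m × Fin 4) where
  carrier := {v | ∀ i j j', v (i, j) = v (i, j')}
  zero_mem' := fun _ _ _ => rfl
  add_mem' := fun hv hw i j j' => by
    simp only [Pi.add_apply, hv i j j', hw i j j']
  smul_mem' := fun c v hv i j j' => by
    simp only [Pi.smul_apply, hv i j j']

theorem d4Pow_dvd_iff {m : ℕ} {v : Fin m × Fin 4 → ZMod 2} (hv : v ∈ d4Pow m) :
    8 ∣ hammingNorm v ↔ ∑ i, v (i, 0) = 0 := by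
  have h1 : hammingNorm v = 4 * hammingNorm (fun i => v (i, 0)) := by
    have hs : (Finset.univ.filter fun p : Fin m × Fin 4 => v p ≠ 0) =
        (Finset.univ.filter fun i : Fin m => v (i, 0) ≠ 0) ×ˢ (Finset.univ : Finset (Fin 4)) := by
      ext ⟨i, j⟩
      have hij : v (i, j) = v (i, 0) := hv i j 0
      simp [hij]
    unfold hammingNorm
    rw [hs, Finset.card_product, Finset.card_univ, Fintype.card_fin, mul_comm]
  have h2 : ((hammingNorm (fun i => v (i, 0)) : ℕ) : ZMod 2) = ∑ i, v (i, 0) := by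
    unfold hammingNorm
    rw [Finset.card_filter, Nat.cast_sum]
    refine Finset.sum_congr rfl fun i _ => ?_
    have : ∀ z : ZMod 2, ((if z ≠ 0 then 1 else 0 : ℕ) : ZMod 2) = z := by decide
    exact this _
  rw [← h2, ZMod.natCast_eq_zero_iff, h1]
  omega

/-- The subcode of `{0000, 1111}^m` of the vectors of weight divisible by `8`. -/
def d4PowZero (m : ℕ) : BinaryCode (Fin m × Fin 4) where
  carrier := {v | v ∈ d4Pow m ∧ 8 ∣ hammingNorm v}
  zero_mem' := ⟨Submodule.zero_mem _, by simp⟩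
  add_mem' := by
    rintro v w ⟨hv, hv8⟩ ⟨hw, hw8⟩
    have hvw := Submodule.add_mem _ hv hw
    rw [d4Pow_dvd_iff hv] at hv8
    rw [d4Pow_dvd_iff hw] at hw8
    refine ⟨hvw, (d4Pow_dvd_iff hvw).2 ?_⟩
    simp only [Pi.add_apply, Finset.sum_add_distrib, hv8, hw8, add_zero]
  smul_mem' := by
    rintro c v ⟨hv, hv8⟩
    have hcv := Submodule.smul_mem _ c hv
    rw [d4Pow_dvd_iff hv] at hv8
    refine ⟨hcv, (d4Pow_dvd_iff hcv).2 ?_⟩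
    simp only [Pi.smul_apply, ← Finset.smul_sum, hv8, smul_zero]

/-- The image of a Kleinian code in `𝔽₂^{4m}`. -/
def KleinianCode.hat {m : ℕ} (K : KleinianCode m) : BinaryCode (Fin m × Fin 4) :=
  AddSubgroup.toZModSubmodule 2 (AddSubgroup.map (kleinHatHom m) K)

/-- Construction A for Kleinian codes: `𝒞(K) = K̂ + d₄^m`. -/
def KleinianCode.codeA {m : ℕ} (K : KleinianCode m) : BinaryCode (Fin m × Fin 4) :=
  K.hat ⊔ d4Pow m

/-- Construction B for Kleinian codes: `𝒞⁺(K) = K̂ + (d₄^m)₀`. -/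
def KleinianCode.codeB {m : ℕ} (K : KleinianCode m) : BinaryCode (Fin m × Fin 4) :=
  K.hat ⊔ d4PowZero m

/-! Lattices. -/

/-- The orthogonal basis of `ℝⁿ` formed by the vectors `αᵢ = √2 eᵢ`, with `(αᵢ, αᵢ) = 2`. -/
noncomputable def latticeAlpha {n : ℕ} (i : Fin n) : EuclideanSpace ℝ (Fin n) :=
  EuclideanSpace.single i (Real.sqrt 2)

/-- `α_c = ∑ cᵢ αᵢ`, where `cᵢ` is read as a number in `{0, 1}`. -/
noncomputable def latticeAlphaWord {n : ℕ} (c : Fin n → ZMod 2) : EuclideanSpace ℝ (Fin n) :=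
  ∑ i, ((c i).val : ℝ) • latticeAlpha i

/-- Construction A for lattices: `ℒ(C) = ∑ᵢ ℤ αᵢ + ∑_{c ∈ C} ℤ (α_c / 2)`. -/
noncomputable def BinaryCode.latticeA {n : ℕ} (C : BinaryCode (Fin n)) :
    Submodule ℤ (EuclideanSpace ℝ (Fin n)) :=
  Submodule.span ℤ {v | ∃ i, v = latticeAlpha i} ⊔
    Submodule.span ℤ {v | ∃ c ∈ C, v = (1 / 2 : ℝ) • latticeAlphaWord c}

/-- Construction B for lattices:
`ℒ⁺(C) = ∑_{i, j} ℤ (αᵢ + αⱼ) + ∑_{c ∈ C} ℤ (α_c / 2)`; the case `i = j` is included. -/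
noncomputable def BinaryCode.latticeB {n : ℕ} (C : BinaryCode (Fin n)) :
    Submodule ℤ (EuclideanSpace ℝ (Fin n)) :=
  Submodule.span ℤ {v | ∃ i j, v = latticeAlpha i + latticeAlpha j} ⊔
    Submodule.span ℤ {v | ∃ c ∈ C, v = (1 / 2 : ℝ) • latticeAlphaWord c}

/-- Two lattices in `ℝⁿ` are isomorphic if an orthogonal transformation carries one onto the
other. -/
def LatticeIsomorphic {n : ℕ} (L M : Submodule ℤ (EuclideanSpace ℝ (Fin n))) : Prop :=
  ∃ g : EuclideanSpace ℝ (Fin n) ≃ₗᵢ[ℝ] EuclideanSpace ℝ (Fin n),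
    ∀ v : EuclideanSpace ℝ (Fin n), v ∈ L ↔ g v ∈ M

/-! Write vectors as `½ ∑ xᵢ αᵢ`. Then `ℒ(D)` consists of the integral `x` reducing into `D` and,
`C` being doubly even, `ℒ⁺(C)` of those reducing into `C` with `4 ∣ ∑ xᵢ` (`coordB`). An isometry
amounts to pulling the `αⱼ` in `ℒ(D)` back to an orthogonal frame `hⱼ` in `ℒ⁺(C)` (`IsGlueFrame`).

Each `hⱼ` satisfies `hⱼ ⬝ᵥ hⱼ = 4`, and the sum condition excludes `±2eᵢ`, so `hⱼ` has exactly four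
nonzero entries, all `±1`. By orthogonality two supports meet in 0, 2 or 4 coordinates. If in 2, the
reflection in a suitable norm-4 vector, which preserves `ℒ⁺(C)` because `C` is self-orthogonal,
makes these two supports equal and separates none that agree (`exists_merge`). For a frame with the
most such coincidences, the supports partition the coordinates into blocks of four; on a block the
signs have sum divisible by 4, so up to sign they are rows of one Hadamard matrix
(`exists_hadamard`).

Hence `C` contains the all-ones word of each block, and self-orthogonality makes its words even on
every block. Even words of length 4 modulo `1111` form the Klein group, so `C` is `𝒞(K)`. Half the
Hadamard matrix preserves the Klein word and turns `4 ∣ ∑ xᵢ` into the parity condition of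
`(d₄^m)₀`, so `D` is `𝒞⁺(K)` (`mem_codeB_iff_of_hadamard`). The same computation gives the converse.
-/

/-! ### Reduction modulo 2 and self-orthogonality. -/

/-- The reduction of an integral vector modulo `2`. -/
def reduceTwo {ι : Type} : (ι → ℤ) →+ (ι → ZMod 2) where
  toFun x := fun i => (x i : ZMod 2)
  map_zero' := by funext i; simp
  map_add' x y := by funext i; simp

@[simp] theorem reduceTwo_apply {ι : Type} (x : ι → ℤ) (i : ι) :
    reduceTwo x i = (x i : ZMod 2) := rfl

theorem intCast_zmod_two_eq_zero_iff (a : ℤ) : (a : ZMod 2) = 0 ↔ 2 ∣ a := by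
  exact_mod_cast ZMod.intCast_zmod_eq_zero_iff_dvd a 2

theorem reduceTwo_two_nsmul {ι : Type} (x : ι → ℤ) : reduceTwo (2 • x) = 0 := by
  funext i
  simp only [reduceTwo_apply, Pi.smul_apply, Pi.zero_apply, intCast_zmod_two_eq_zero_iff]
  exact ⟨x i, by simp⟩

theorem reduceTwo_eq_iff {ι : Type} {x y : ι → ℤ} :
    reduceTwo x = reduceTwo y ↔ ∃ w : ι → ℤ, x = y + 2 • w := by
  constructor
  · intro h
    have h2 : ∀ i, ∃ w : ℤ, x i - y i = 2 * w := fun i => by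
      have := congrFun h i
      rw [reduceTwo_apply, reduceTwo_apply, ← sub_eq_zero, ← Int.cast_sub,
        intCast_zmod_two_eq_zero_iff] at this
      exact this
    choose w hw using h2
    refine ⟨w, funext fun i => ?_⟩
    have := hw i
    change x i = y i + 2 • w i
    rw [two_nsmul]
    linarith
  · rintro ⟨w, rfl⟩
    rw [map_add, reduceTwo_two_nsmul, add_zero]

/-- The lift to `{0, 1} ⊂ ℤ` of a binary vector. -/
def binaryLift {ι : Type} (c : ι → ZMod 2) : ι → ℤ := fun i => ((c i).val : ℤ)

@[simp] theorem reduceTwo_binaryLift {ι : Type} (c : ι → ZMod 2) :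
    reduceTwo (binaryLift c) = c := by
  funext i
  simp [binaryLift]

theorem sum_val_eq_hammingNorm {ι : Type} [Fintype ι] (c : ι → ZMod 2) :
    ∑ i, (c i).val = hammingNorm c := by
  unfold hammingNorm
  rw [Finset.card_filter]
  refine Finset.sum_congr rfl fun i _ => ?_
  have : ∀ z : ZMod 2, z.val = if z ≠ 0 then 1 else 0 := by decide
  exact this _

/-- The integral vectors that reduce to a codeword and have coordinate sum divisible by `4`:
the coordinate vectors of Construction B. -/
def BinaryCode.coordB {ι : Type} [Fintype ι] (C : BinaryCode ι) : AddSubgroup (ι → ℤ) where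
  carrier := {x | reduceTwo x ∈ C ∧ 4 ∣ ∑ i, x i}
  zero_mem' := ⟨by rw [map_zero]; exact C.zero_mem, by simp⟩
  add_mem' := by
    rintro x y ⟨hx, hx4⟩ ⟨hy, hy4⟩
    refine ⟨by rw [map_add]; exact C.add_mem hx hy, ?_⟩
    simp only [Pi.add_apply, Finset.sum_add_distrib]
    exact dvd_add hx4 hy4
  neg_mem' := by
    rintro x ⟨hx, hx4⟩
    refine ⟨by rw [map_neg]; exact C.neg_mem hx, ?_⟩
    simpa only [Pi.neg_apply, Finset.sum_neg_distrib, dvd_neg] using hx4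

theorem BinaryCode.mem_coordB {ι : Type} [Fintype ι] {C : BinaryCode ι} {x : ι → ℤ} :
    x ∈ C.coordB ↔ reduceTwo x ∈ C ∧ 4 ∣ ∑ i, x i := Iff.rfl

/-- A doubly-even code is self-orthogonal. -/
theorem BinaryCode.IsDoublyEven.sum_mul_eq_zero {ι : Type} [Fintype ι] {C : BinaryCode ι}
    (hC : C.IsDoublyEven) {x y : ι → ZMod 2} (hx : x ∈ C) (hy : y ∈ C) :
    ∑ i, x i * y i = 0 := by
  have h1 := hC x hx
  have h2 := hC y hy
  have h3 := hC _ (C.add_mem hx hy)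
  rw [← sum_val_eq_hammingNorm] at h1 h2 h3
  have h4 : ∑ i, ((x + y) i).val + 2 * ∑ i, (x i).val * (y i).val =
      ∑ i, (x i).val + ∑ i, (y i).val := by
    rw [Finset.mul_sum, ← Finset.sum_add_distrib, ← Finset.sum_add_distrib]
    refine Finset.sum_congr rfl fun i _ => ?_
    have : ∀ a b : ZMod 2, (a + b).val + 2 * (a.val * b.val) = a.val + b.val := by decide
    exact this _ _
  have h5 : 2 ∣ ∑ i, (x i).val * (y i).val := by omega
  rw [← ZMod.natCast_eq_zero_iff] at h5
  rw [← h5]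
  push_cast
  simp

theorem BinaryCode.IsDoublyEven.two_dvd_dotProduct {ι : Type} [Fintype ι] {C : BinaryCode ι}
    (hC : C.IsDoublyEven) {x y : ι → ℤ} (hx : reduceTwo x ∈ C) (hy : reduceTwo y ∈ C) :
    2 ∣ x ⬝ᵥ y := by
  rw [← intCast_zmod_two_eq_zero_iff, ← hC.sum_mul_eq_zero hx hy]
  simp [dotProduct]

theorem BinaryCode.IsDoublyEven.binaryLift_mem_coordB {ι : Type} [Fintype ι] {C : BinaryCode ι}
    (hC : C.IsDoublyEven) {c : ι → ZMod 2} (hc : c ∈ C) : binaryLift c ∈ C.coordB := by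
  refine ⟨by simpa using hc, ?_⟩
  have := hC c hc
  rw [← sum_val_eq_hammingNorm] at this
  simp only [binaryLift]
  exact_mod_cast this

/-! Coordinates of the lattices. -/

/-- The vector `½ ∑ xᵢ αᵢ`. -/
noncomputable def halfAlpha {n : ℕ} : (Fin n → ℤ) →ₗ[ℤ] EuclideanSpace ℝ (Fin n) where
  toFun x := WithLp.toLp 2 fun i => (x i : ℝ) * (Real.sqrt 2 / 2)
  map_add' x y := by ext i; simp [add_mul]
  map_smul' a x := by ext i; simp [mul_assoc]

@[simp] theorem halfAlpha_apply {n : ℕ} (x : Fin n → ℤ) (i : Fin n) :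
    halfAlpha x i = (x i : ℝ) * (Real.sqrt 2 / 2) := rfl

theorem halfAlpha_injective {n : ℕ} : Function.Injective (halfAlpha (n := n)) := by
  intro x y h
  funext i
  have h1 : halfAlpha x i = halfAlpha y i := by rw [h]
  rw [halfAlpha_apply, halfAlpha_apply] at h1
  have h2 : Real.sqrt 2 / 2 ≠ 0 := by positivity
  exact_mod_cast mul_right_cancel₀ h2 h1

theorem inner_halfAlpha {n : ℕ} (x y : Fin n → ℤ) :
    inner ℝ (halfAlpha x) (halfAlpha y) = ((x ⬝ᵥ y : ℤ) : ℝ) / 2 := by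
  have h : Real.sqrt 2 * Real.sqrt 2 = 2 := Real.mul_self_sqrt (by norm_num)
  simp only [PiLp.inner_apply, halfAlpha_apply, dotProduct, Int.cast_sum, Int.cast_mul,
    Finset.sum_div]
  refine Finset.sum_congr rfl fun i _ => ?_
  simp only [RCLike.inner_apply, conj_trivial]
  linear_combination ((x i : ℝ) * y i / 4) * h

theorem latticeAlpha_eq {n : ℕ} (i : Fin n) :
    latticeAlpha i = halfAlpha (2 • Pi.single i 1) := by
  ext j
  by_cases h : j = i
  · subst h; simp [latticeAlpha, mul_div_cancel₀]
  · simp [latticeAlpha, h]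

theorem half_latticeAlphaWord {n : ℕ} (c : Fin n → ZMod 2) :
    (1 / 2 : ℝ) • latticeAlphaWord c = halfAlpha (binaryLift c) := by
  ext j
  simp [latticeAlphaWord, latticeAlpha, binaryLift, Finset.sum_apply, Pi.single_apply]
  ring

theorem exists_eq_binaryLift_add {ι : Type} (x : ι → ℤ) :
    ∃ w : ι → ℤ, x = binaryLift (reduceTwo x) + 2 • w :=
  reduceTwo_eq_iff.1 (reduceTwo_binaryLift _).symm

theorem eq_sum_zsmul_single {n : ℕ} (w : Fin n → ℤ) :
    halfAlpha (2 • w) = ∑ i, w i • latticeAlpha i := by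
  have : w = ∑ i, w i • Pi.single i (1 : ℤ) := by
    funext j
    simp [Finset.sum_apply, Pi.single_apply]
  conv_lhs => rw [this]
  simp only [latticeAlpha_eq, Finset.smul_sum, map_sum, map_nsmul, map_zsmul]
  exact Finset.sum_congr rfl fun i _ => smul_comm _ _ _

theorem BinaryCode.mem_latticeA {n : ℕ} {D : BinaryCode (Fin n)}
    {v : EuclideanSpace ℝ (Fin n)} :
    v ∈ D.latticeA ↔ ∃ y, reduceTwo y ∈ D ∧ halfAlpha y = v := by
  constructor
  · intro hv
    let N : Submodule ℤ (EuclideanSpace ℝ (Fin n)) :=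
      Submodule.map halfAlpha
        (AddSubgroup.toIntSubmodule (AddSubgroup.comap reduceTwo D.toAddSubgroup))
    have hN : D.latticeA ≤ N := by
      refine sup_le (Submodule.span_le.2 ?_) (Submodule.span_le.2 ?_)
      · rintro _ ⟨i, rfl⟩
        refine ⟨_, ?_, (latticeAlpha_eq i).symm⟩
        change reduceTwo _ ∈ D
        rw [reduceTwo_two_nsmul]
        exact D.zero_mem
      · rintro _ ⟨c, hc, rfl⟩
        refine ⟨_, ?_, (half_latticeAlphaWord c).symm⟩
        change reduceTwo _ ∈ D
        rwa [reduceTwo_binaryLift]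
    exact hN hv
  · rintro ⟨y, hy, rfl⟩
    obtain ⟨w, hw⟩ := exists_eq_binaryLift_add y
    rw [hw, map_add, add_comm]
    refine Submodule.add_mem_sup ?_ ?_
    · rw [eq_sum_zsmul_single]
      exact Submodule.sum_mem _ fun i _ =>
        Submodule.smul_mem _ _ (Submodule.subset_span ⟨i, rfl⟩)
    · rw [← half_latticeAlphaWord]
      exact Submodule.subset_span ⟨_, hy, rfl⟩

/-- Double evenness gives the 0/1 lift of a codeword a sum divisible by 4; what remains is an even
integral combination of the `αᵢ`. -/
theorem BinaryCode.mem_latticeB {n : ℕ} {C : BinaryCode (Fin n)} (hC : C.IsDoublyEven)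
    {v : EuclideanSpace ℝ (Fin n)} :
    v ∈ C.latticeB ↔ ∃ x ∈ C.coordB, halfAlpha x = v := by
  constructor
  · intro hv
    let N : Submodule ℤ (EuclideanSpace ℝ (Fin n)) :=
      Submodule.map halfAlpha (AddSubgroup.toIntSubmodule C.coordB)
    have hN : C.latticeB ≤ N := by
      refine sup_le (Submodule.span_le.2 ?_) (Submodule.span_le.2 ?_)
      · rintro _ ⟨i, j, rfl⟩
        refine ⟨2 • Pi.single i 1 + 2 • Pi.single j 1, ⟨?_, ?_⟩, ?_⟩
        · rw [map_add, reduceTwo_two_nsmul, reduceTwo_two_nsmul, add_zero]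
          exact C.zero_mem
        · simp [Finset.sum_add_distrib, ← Finset.mul_sum]
        · rw [map_add, latticeAlpha_eq, latticeAlpha_eq]
      · rintro _ ⟨c, hc, rfl⟩
        exact ⟨_, hC.binaryLift_mem_coordB hc, (half_latticeAlphaWord c).symm⟩
    exact hN hv
  · rintro ⟨x, hx, rfl⟩
    obtain ⟨w, hw⟩ := exists_eq_binaryLift_add x
    have hw4 : 4 ∣ ∑ i, (2 • w) i := by
      have h1 := (C.coordB.sub_mem hx (hC.binaryLift_mem_coordB hx.1)).2
      rwa [show x - binaryLift (reduceTwo x) = 2 • w by rw [sub_eq_iff_eq_add', ← hw]] at h1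
    have hw2 : 2 ∣ ∑ i, w i := by
      simp only [Pi.smul_apply, nsmul_eq_mul, ← Finset.mul_sum, Nat.cast_ofNat] at hw4
      omega
    rw [hw, map_add, add_comm]
    refine Submodule.add_mem_sup ?_ ?_
    · rw [eq_sum_zsmul_single]
      obtain ⟨s, hs⟩ := hw2
      rcases isEmpty_or_nonempty (Fin n) with he | ⟨⟨i₀⟩⟩
      · simp
      -- Replacing each `αᵢ` by `αᵢ + α_{i₀}` adds `(∑ wᵢ) α_{i₀} = 2s α_{i₀}`, itself a multiple of
      -- the generator with `i = j = i₀`.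
      have h1 : ∑ i, w i • latticeAlpha i =
          ∑ i, w i • (latticeAlpha i + latticeAlpha i₀) -
            s • (latticeAlpha i₀ + latticeAlpha i₀) := by
        simp only [smul_add, Finset.sum_add_distrib, ← Finset.sum_smul, hs]
        module
      rw [h1]
      exact Submodule.sub_mem _ (Submodule.sum_mem _ fun i _ =>
        Submodule.smul_mem _ _ (Submodule.subset_span ⟨i, i₀, rfl⟩))
        (Submodule.smul_mem _ _ (Submodule.subset_span ⟨i₀, i₀, rfl⟩))
    · rw [← half_latticeAlphaWord]
      exact Submodule.subset_span ⟨_, hx.1, rfl⟩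

/-! ### Isometries encoded as integral frames. -/

/-- An integral description of an isometry between `ℒ⁺(C)` and `ℒ(D)`: the vectors `½ ∑ᵢ hⱼᵢ αᵢ`
are an orthogonal frame of vectors of norm `2` with respect to which `ℒ⁺(C)` is `ℒ(D)`. -/
structure IsGlueFrame {ι κ : Type} [Fintype ι] [Fintype κ] [DecidableEq κ] (C : BinaryCode ι)
    (D : BinaryCode κ) (h : κ → ι → ℤ) : Prop where
  dotProduct_eq : ∀ j k, h j ⬝ᵥ h k = if j = k then 4 else 0
  mem_iff : ∀ y, reduceTwo y ∈ D ↔ ∃ x ∈ C.coordB, ∑ j, y j • h j = 2 • x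

theorem sum_smul_halfAlpha {n : ℕ} (y : Fin n → ℤ) (h : Fin n → Fin n → ℤ) :
    ∑ j, y j • halfAlpha (h j) = halfAlpha (∑ j, y j • h j) := by
  simp only [map_sum, map_zsmul]

theorem two_nsmul_halfAlpha {n : ℕ} (y : Fin n → ℤ) :
    2 • halfAlpha y = ∑ j, y j • latticeAlpha j := by
  rw [← eq_sum_zsmul_single, map_nsmul]

theorem two_nsmul_injective {n : ℕ} {v w : EuclideanSpace ℝ (Fin n)} (h : 2 • v = 2 • w) :
    v = w := by
  rw [two_nsmul, two_nsmul, ← two_smul ℝ, ← two_smul ℝ w] at h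
  exact smul_right_injective _ (two_ne_zero (α := ℝ)) h

/-- The frame is the preimage of the `αⱼ`; the factor 2 in `mem_iff` arises because `½ ∑ yⱼ αⱼ`
pulls back to half of `∑ yⱼ hⱼ`. -/
theorem exists_isGlueFrame {n : ℕ} {C D : BinaryCode (Fin n)} (hC : C.IsDoublyEven)
    (hiso : LatticeIsomorphic C.latticeB D.latticeA) :
    ∃ h : Fin n → Fin n → ℤ, IsGlueFrame C D h := by
  obtain ⟨g, hg⟩ := hiso
  have h1 : ∀ j, ∃ x ∈ C.coordB, halfAlpha x = g.symm (latticeAlpha j) := fun j => by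
    rw [← BinaryCode.mem_latticeB hC, hg, g.apply_symm_apply, BinaryCode.mem_latticeA]
    refine ⟨_, ?_, (latticeAlpha_eq j).symm⟩
    rw [reduceTwo_two_nsmul]
    exact D.zero_mem
  choose h hh hg' using h1
  refine ⟨h, fun j k => ?_, fun y => ?_⟩
  · have h2 : ((h j ⬝ᵥ h k : ℤ) : ℝ) = if j = k then 4 else 0 := by
      have h3 := inner_halfAlpha (h j) (h k)
      rw [hg', hg', LinearIsometryEquiv.inner_map_map, latticeAlpha_eq, latticeAlpha_eq,
        inner_halfAlpha] at h3
      have h4 : (2 • Pi.single j 1 : Fin n → ℤ) ⬝ᵥ (2 • Pi.single k 1) =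
          if j = k then 4 else 0 := by
        by_cases hjk : j = k
        · subst hjk; simp [dotProduct_smul, -nsmul_eq_mul]
        · simp [dotProduct_smul, -nsmul_eq_mul, hjk]
      rw [h4] at h3
      have h5 : ((h j ⬝ᵥ h k : ℤ) : ℝ) = ((if j = k then 4 else 0 : ℤ) : ℝ) := by linarith
      rw [h5]
      push_cast
      rfl
    exact_mod_cast h2
  · have h2 : 2 • g.symm (halfAlpha y) = halfAlpha (∑ j, y j • h j) := by
      rw [← map_nsmul, two_nsmul_halfAlpha, map_sum, ← sum_smul_halfAlpha]
      exact Finset.sum_congr rfl fun j _ => by rw [map_zsmul, hg']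
    have h3 : reduceTwo y ∈ D ↔ halfAlpha y ∈ D.latticeA := by
      rw [BinaryCode.mem_latticeA]
      refine ⟨fun h => ⟨y, h, rfl⟩, ?_⟩
      rintro ⟨y', hy', he⟩
      rwa [← halfAlpha_injective he]
    rw [h3, ← g.apply_symm_apply (halfAlpha y), ← hg, BinaryCode.mem_latticeB hC]
    refine exists_congr fun x => and_congr_right fun _ => ?_
    rw [← halfAlpha_injective.eq_iff, ← h2, map_nsmul]
    refine ⟨fun h => by rw [h], fun h => ?_⟩
    exact (two_nsmul_injective h).symm

/-- `mem_iff` only concerns those `x` whose coordinates in the frame are integral; `hsurj` says that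
this is all of `ℒ⁺(C)`. -/
theorem IsGlueFrame.latticeIsomorphic {n : ℕ} {C D : BinaryCode (Fin n)} (hC : C.IsDoublyEven)
    {h : Fin n → Fin n → ℤ} (hh : IsGlueFrame C D h)
    (hsurj : ∀ x ∈ C.coordB, ∃ y : Fin n → ℤ, ∑ j, y j • h j = 2 • x) :
    LatticeIsomorphic C.latticeB D.latticeA := by
  -- `halfAlpha (h j)` has squared length `4 / 2 = 2`.
  let b : Fin n → EuclideanSpace ℝ (Fin n) := fun j => (Real.sqrt 2)⁻¹ • halfAlpha (h j)
  have h2 : Real.sqrt 2 * Real.sqrt 2 = 2 := Real.mul_self_sqrt (by norm_num)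
  have h0 : Real.sqrt 2 ≠ 0 := by positivity
  have hb : Orthonormal ℝ b := by
    rw [orthonormal_iff_ite]
    intro j k
    simp only [b, inner_smul_left, inner_smul_right, inner_halfAlpha, hh.dotProduct_eq]
    split_ifs
    · simp only [conj_trivial]
      field_simp
      norm_num
    · simp
  let B := OrthonormalBasis.mk hb
    (hb.linearIndependent.span_eq_top_of_card_eq_finrank' (by simp)).ge
  have hB : ∀ j, B j = b j := fun j => by simp [B]
  have key : ∀ y : Fin n → ℤ,
      2 • B.repr.symm (halfAlpha y) = halfAlpha (∑ j, y j • h j) := fun y => by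
    rw [← B.sum_repr (B.repr.symm (halfAlpha y)), ← sum_smul_halfAlpha, Finset.smul_sum]
    refine Finset.sum_congr rfl fun j _ => ?_
    rw [LinearIsometryEquiv.apply_symm_apply, hB, halfAlpha_apply, ← Int.cast_smul_eq_zsmul ℝ,
      smul_smul, ← Nat.cast_smul_eq_nsmul ℝ, smul_smul]
    congr 1
    field_simp
    norm_num [mul_comm]
  have key2 : ∀ x y : Fin n → ℤ,
      B.repr.symm (halfAlpha y) = halfAlpha x ↔ ∑ j, y j • h j = 2 • x := fun x y => by
    rw [← halfAlpha_injective.eq_iff, ← key, map_nsmul]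
    exact ⟨fun h => by rw [h], fun h => two_nsmul_injective h⟩
  refine ⟨B.repr, fun v => ?_⟩
  rw [BinaryCode.mem_latticeB hC, BinaryCode.mem_latticeA]
  constructor
  · rintro ⟨x, hx, rfl⟩
    obtain ⟨y, hy⟩ := hsurj x hx
    refine ⟨y, (hh.mem_iff y).2 ⟨x, hx, hy⟩, ?_⟩
    rw [← (key2 x y).2 hy, LinearIsometryEquiv.apply_symm_apply]
  · rintro ⟨y, hy, hyv⟩
    obtain ⟨x, hx, hxy⟩ := (hh.mem_iff y).1 hy
    refine ⟨x, hx, ?_⟩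
    rw [← (key2 x y).2 hxy, hyv, LinearIsometryEquiv.symm_apply_apply]

/-- For a square matrix, `H Hᵀ = 4` gives `Hᵀ H = 4`. It follows that every coordinate lies in the
support of some frame vector. -/
theorem sum_sq_eq_four_of_orthogonal {ι : Type} [Fintype ι] [DecidableEq ι] {h : ι → ι → ℤ}
    (hh : ∀ j k, h j ⬝ᵥ h k = if j = k then 4 else 0) (i : ι) : ∑ j, h j i * h j i = 4 := by
  let H : Matrix ι ι ℚ := Matrix.of fun j i => (h j i : ℚ)
  have h1 : H * ((1 / 4 : ℚ) • H.transpose) = 1 := by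
    ext j k
    have h2 : (∑ i, (h j i : ℚ) * h k i) = if j = k then 4 else 0 := by
      have := hh j k
      rw [dotProduct] at this
      exact_mod_cast this
    rw [Matrix.mul_smul, Matrix.smul_apply, Matrix.mul_apply, Matrix.one_apply]
    simp only [H, Matrix.transpose_apply, Matrix.of_apply, h2]
    split_ifs <;> norm_num
  rw [mul_eq_one_comm] at h1
  have h3 := congrFun (congrFun h1 i) i
  rw [Matrix.smul_mul, Matrix.smul_apply, Matrix.mul_apply, Matrix.one_apply_eq] at h3
  simp only [H, Matrix.transpose_apply, Matrix.of_apply, smul_eq_mul] at h3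
  have h4 : (∑ j, (h j i : ℚ) * h j i) = 4 := by linarith
  exact_mod_cast h4

theorem IsGlueFrame.mem_coordB {ι κ : Type} [Fintype ι] [Fintype κ] [DecidableEq κ]
    {C : BinaryCode ι} {D : BinaryCode κ} {h : κ → ι → ℤ} (hh : IsGlueFrame C D h) (j : κ) :
    h j ∈ C.coordB := by
  obtain ⟨x, hx, hxj⟩ := (hh.mem_iff (2 • Pi.single j 1)).1 (by
    rw [reduceTwo_two_nsmul]
    exact D.zero_mem)
  have h1 : h j = x := by
    have h2 : ∑ k, (2 • Pi.single j (1 : ℤ) : κ → ℤ) k • h k = 2 • h j := by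
      rw [Finset.sum_eq_single j]
      · simp
      · intro k _ hk
        simp [hk]
      · simp
    rw [h2] at hxj
    funext i
    have := congrFun hxj i
    simpa using this
  rwa [h1]

/-! ### Reflections and the merging of supports. -/

/-- The image of a frame under the reflection in a vector `γ` of norm `4`. -/
theorem IsGlueFrame.reflect {ι κ : Type} [Fintype ι] [Fintype κ] [DecidableEq κ]
    {C : BinaryCode ι} (hC : C.IsDoublyEven) {D : BinaryCode κ} {h : κ → ι → ℤ}
    (hh : IsGlueFrame C D h) {γ : ι → ℤ} (hγ : γ ∈ C.coordB) (hγ4 : γ ⬝ᵥ γ = 4) {a : κ → ℤ}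
    (ha : ∀ j, γ ⬝ᵥ h j = 2 * a j) : IsGlueFrame C D fun j => h j - a j • γ := by
  refine ⟨fun j k => ?_, fun y => ?_⟩
  · have h1 := hh.dotProduct_eq j k
    have h2 : h j ⬝ᵥ γ = 2 * a j := by rw [dotProduct_comm, ha]
    rw [sub_dotProduct, dotProduct_sub, dotProduct_sub, smul_dotProduct, smul_dotProduct,
      dotProduct_smul, dotProduct_smul, h1, h2, ha, hγ4]
    simp only [smul_eq_mul]
    ring
  · have hsum : ∑ j, y j • (h j - a j • γ) = ∑ j, y j • h j - (∑ j, y j * a j) • γ := by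
      rw [Finset.sum_smul, ← Finset.sum_sub_distrib]
      exact Finset.sum_congr rfl fun j _ => by rw [smul_sub, smul_smul]
    have hdot : γ ⬝ᵥ ∑ j, y j • h j = 2 * ∑ j, y j * a j := by
      rw [dotProduct_sum, Finset.mul_sum]
      refine Finset.sum_congr rfl fun j _ => ?_
      rw [dotProduct_smul, ha, smul_eq_mul]
      ring
    rw [hh.mem_iff, hsum]
    constructor
    · rintro ⟨x, hx, hxy⟩
      -- The reflection sends `x` to `x - bγ` with `γ ⬝ᵥ x = 2b`; self-orthogonality of `C` makes
      -- `b` an integer.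
      obtain ⟨b, hb⟩ := hC.two_dvd_dotProduct hγ.1 hx.1
      rw [hxy, dotProduct_smul, hb, nsmul_eq_mul] at hdot
      refine ⟨x - b • γ, C.coordB.sub_mem hx (C.coordB.zsmul_mem hγ b), ?_⟩
      have h3 : ∑ j, y j * a j = 2 * b := by push_cast at hdot; linarith
      rw [hxy, h3]
      module
    · rintro ⟨x, hx, hxy⟩
      obtain ⟨b, hb⟩ := hC.two_dvd_dotProduct hγ.1 hx.1
      rw [sub_eq_iff_eq_add] at hxy
      rw [hxy, dotProduct_add, dotProduct_smul, dotProduct_smul, hb, hγ4, nsmul_eq_mul,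
        smul_eq_mul] at hdot
      refine ⟨x - b • γ, C.coordB.sub_mem hx (C.coordB.zsmul_mem hγ b), ?_⟩
      have h3 : ∑ j, y j * a j = -(2 * b) := by push_cast at hdot; linarith
      rw [hxy, h3]
      module

/-- An entry `±2` would exhaust the norm, leaving coordinate sum `±2`, which is not divisible by 4.
-/
theorem entry_eq_zero_or_of_norm_four {ι : Type} [Fintype ι] {x : ι → ℤ} (h4 : x ⬝ᵥ x = 4)
    (hs : 4 ∣ ∑ i, x i) (i : ι) : x i = 0 ∨ x i = 1 ∨ x i = -1 := by
  classical
  rw [dotProduct, ← Finset.add_sum_erase _ _ (Finset.mem_univ i)] at h4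
  rw [← Finset.add_sum_erase _ _ (Finset.mem_univ i)] at hs
  have hnn : 0 ≤ ∑ j ∈ Finset.univ.erase i, x j * x j :=
    Finset.sum_nonneg fun j _ => mul_self_nonneg _
  have hle : x i ≤ 2 := by nlinarith
  have hge : -2 ≤ x i := by nlinarith
  have hne : ∀ s : ℤ, x i = s → s * s = 4 → ¬ 4 ∣ s → False := by
    intro s hxs hss hs4
    rw [hxs, hss, add_eq_left] at h4
    rw [Finset.sum_eq_zero_iff_of_nonneg fun j _ => mul_self_nonneg _] at h4
    rw [Finset.sum_eq_zero fun j hj => mul_self_eq_zero.1 (h4 j hj), add_zero, hxs] at hs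
    exact hs4 hs
  have h2 : x i ≠ 2 := fun h => hne 2 h (by norm_num) (by norm_num)
  have h3 : x i ≠ -2 := fun h => hne (-2) h (by norm_num) (by norm_num)
  omega

/-- If two vectors of a frame have supports that meet in exactly two coordinates, then there is a
vector of norm `4` whose reflection fixes the first one and gives the second one the support of
the first one. -/
theorem exists_reflection_vector {ι : Type} [Fintype ι] [DecidableEq ι] {C : BinaryCode ι}
    {x y : ι → ℤ} (hx : x ∈ C.coordB) (hy : y ∈ C.coordB) (hx4 : x ⬝ᵥ x = 4) (hy4 : y ⬝ᵥ y = 4)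
    (hxy : x ⬝ᵥ y = 0) (hmeet : ∑ i, (x i * x i) * (y i * y i) = 2) :
    ∃ γ ∈ C.coordB, γ ⬝ᵥ γ = 4 ∧ γ ⬝ᵥ x = 0 ∧ γ ⬝ᵥ y = 2 ∧
      reduceTwo γ = reduceTwo x + reduceTwo y := by
  have ex := entry_eq_zero_or_of_norm_four hx4 hx.2
  have ey := entry_eq_zero_or_of_norm_four hy4 hy.2
  obtain ⟨i₀, hi₀x, hi₀y⟩ : ∃ i, x i ≠ 0 ∧ y i = 0 := by
    by_contra! hcon
    have h1 : ∑ i, (x i * x i) * (y i * y i) = x ⬝ᵥ x := Finset.sum_congr rfl fun i _ => by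
      have := hcon i
      rcases ex i with h | h | h <;> rcases ey i with h' | h' | h' <;> simp_all
    omega
  -- `u` is `y` on the part of its support outside that of `x`, and `-x` on the part of the support
  -- of `x` outside that of `y`. Adding `s` flips its sign at `i₀`, which corrects both `u ⬝ᵥ x =
  -- -2` and the sum, congruent to 2 modulo 4.
  let u : ι → ℤ := fun i => y i * (1 - x i * x i) - x i * (1 - y i * y i)
  let s : ι → ℤ := Pi.single i₀ (2 * x i₀)
  have hux : u ⬝ᵥ x = -2 := by
    have : u ⬝ᵥ x = -(x ⬝ᵥ x) + ∑ i, (x i * x i) * (y i * y i) := by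
      simp only [dotProduct, u, ← Finset.sum_neg_distrib, ← Finset.sum_add_distrib]
      refine Finset.sum_congr rfl fun i _ => ?_
      rcases ex i with h | h | h <;> rcases ey i with h' | h' | h' <;> rw [h, h'] <;> norm_num
    omega
  have huy : u ⬝ᵥ y = 2 := by
    have : u ⬝ᵥ y = y ⬝ᵥ y - ∑ i, (x i * x i) * (y i * y i) := by
      simp only [dotProduct, u, ← Finset.sum_sub_distrib]
      refine Finset.sum_congr rfl fun i _ => ?_
      rcases ex i with h | h | h <;> rcases ey i with h' | h' | h' <;> rw [h, h'] <;> norm_num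
    omega
  have huu : u ⬝ᵥ u = 4 := by
    have : u ⬝ᵥ u = x ⬝ᵥ x + y ⬝ᵥ y - 2 * ∑ i, (x i * x i) * (y i * y i) := by
      simp only [dotProduct, u, Finset.mul_sum, ← Finset.sum_add_distrib,
        ← Finset.sum_sub_distrib]
      refine Finset.sum_congr rfl fun i _ => ?_
      rcases ex i with h | h | h <;> rcases ey i with h' | h' | h' <;> rw [h, h'] <;> norm_num
    omega
  have hui₀ : u i₀ = -x i₀ := by simp [u, hi₀y]
  have hsq : x i₀ * x i₀ = 1 := by
    rcases ex i₀ with h | h | h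
    · exact absurd h hi₀x
    · rw [h]; norm_num
    · rw [h]; norm_num
  have hred : reduceTwo (u + s) = reduceTwo x + reduceTwo y := by
    have h1 : ∀ i, ∃ w : ℤ, (u + s) i = (x + y) i + 2 * w := by
      intro i
      have hs : ∃ w : ℤ, s i = 2 * w := ⟨(Pi.single i₀ (x i₀) : ι → ℤ) i, by
        by_cases hi : i = i₀
        · subst hi; simp [s]
        · simp [s, hi]⟩
      obtain ⟨w, hw⟩ := hs
      have hu : 2 ∣ u i - (x i + y i) := by
        simp only [u]
        rcases ex i with h | h | h <;> rcases ey i with h' | h' | h' <;> rw [h, h'] <;> norm_num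
      obtain ⟨w', hw'⟩ := hu
      refine ⟨w + w', ?_⟩
      simp only [Pi.add_apply]
      linarith
    choose w hw using h1
    rw [← map_add, reduceTwo_eq_iff]
    refine ⟨w, funext fun i => ?_⟩
    rw [hw i, Pi.add_apply (f := x + y)]
    change _ = _ + 2 • w i
    rw [two_nsmul, two_mul]
  have hsum : 4 ∣ ∑ i, (u + s) i := by
    have h1 : ∑ i, (u + s) i = ∑ i, u i + 2 * x i₀ := by
      simp [s, Finset.sum_add_distrib]
    -- On the common support `u` vanishes and `y - x + 1 - xy` is 0 or 4. Summing, `∑ u ≡ ∑ y - ∑ x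
    -- + 2 ≡ 2` modulo 4.
    have h2 : 4 ∣ ∑ i, (u i - (y i - x i + ((x i * x i) * (y i * y i) - x i * y i))) := by
      refine Finset.dvd_sum fun i _ => ?_
      simp only [u]
      rcases ex i with h | h | h <;> rcases ey i with h' | h' | h' <;> rw [h, h'] <;> norm_num
    simp only [Finset.sum_sub_distrib, Finset.sum_add_distrib] at h2
    rw [dotProduct] at hxy
    have h3 := hx.2
    have h4 := hy.2
    rcases ex i₀ with h | h | h
    · exact absurd h hi₀x
    · omega
    · omega
  refine ⟨u + s, ⟨?_, hsum⟩, ?_, ?_, ?_, hred⟩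
  · rw [hred]
    exact C.add_mem hx.1 hy.1
  · simp only [add_dotProduct, dotProduct_add, huu, s, single_dotProduct, dotProduct_single, hui₀,
      Pi.add_apply, Pi.single_eq_same]
    linarith
  · simp only [add_dotProduct, hux, s, single_dotProduct]
    linarith
  · simp only [add_dotProduct, huy, s, single_dotProduct, hi₀y, mul_zero, add_zero]

/-- Two vectors of a frame have equal supports, or disjoint supports, or there is a frame with more
pairs of vectors of equal support. -/
theorem IsGlueFrame.exists_merge {ι κ : Type} [Fintype ι] [Fintype κ] [DecidableEq κ]
    {C : BinaryCode ι} (hC : C.IsDoublyEven) {D : BinaryCode κ} {h : κ → ι → ℤ}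
    (hh : IsGlueFrame C D h) {j k : κ} (hne : reduceTwo (h j) ≠ reduceTwo (h k)) {i₁ : ι}
    (hi₁ : h j i₁ * h k i₁ ≠ 0) :
    ∃ h', IsGlueFrame C D h' ∧
      (∀ t t', reduceTwo (h t) = reduceTwo (h t') → reduceTwo (h' t) = reduceTwo (h' t')) ∧
      reduceTwo (h' j) = reduceTwo (h' k) := by
  classical
  have h4 : ∀ t, h t ⬝ᵥ h t = 4 := fun t => by rw [hh.dotProduct_eq, if_pos rfl]
  have ex : ∀ t i, h t i = 0 ∨ h t i = 1 ∨ h t i = -1 := fun t =>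
    entry_eq_zero_or_of_norm_four (h4 t) (hh.mem_coordB t).2
  have hjk : j ≠ k := fun e => hne (by rw [e])
  have h0 : h j ⬝ᵥ h k = 0 := by rw [hh.dotProduct_eq, if_neg hjk]
  have hmeet : ∑ i, (h j i * h j i) * (h k i * h k i) = 2 := by
    have hpos : 0 < ∑ i, (h j i * h j i) * (h k i * h k i) :=
      Finset.sum_pos' (fun i _ => mul_nonneg (mul_self_nonneg _) (mul_self_nonneg _))
        ⟨i₁, Finset.mem_univ _, by
          rw [mul_mul_mul_comm]
          exact mul_self_pos.2 hi₁⟩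
    -- The number of common support coordinates has the parity of `h j ⬝ᵥ h k = 0`; it is positive,
    -- at most 4, and not 4 since the supports differ.
    have heven : 2 ∣ ∑ i, ((h j i * h j i) * (h k i * h k i) - h j i * h k i) := by
      refine Finset.dvd_sum fun i _ => ?_
      rcases ex j i with h | h | h <;> rcases ex k i with h' | h' | h' <;> rw [h, h'] <;> norm_num
    rw [Finset.sum_sub_distrib] at heven
    have hle : ∑ i, (h j i * h j i) * (h k i * h k i) ≤ h j ⬝ᵥ h j :=
      Finset.sum_le_sum fun i _ => by
        rcases ex j i with h | h | h <;> rcases ex k i with h' | h' | h' <;> rw [h, h'] <;>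
          norm_num
    have hne4 : ∑ i, (h j i * h j i) * (h k i * h k i) ≠ 4 := by
      intro he
      have h1 : ∑ i, (h j i * h j i - h k i * h k i) * (h j i * h j i - h k i * h k i) = 0 := by
        have h2 : ∑ i, (h j i * h j i - h k i * h k i) * (h j i * h j i - h k i * h k i) =
            h j ⬝ᵥ h j + h k ⬝ᵥ h k - 2 * ∑ i, (h j i * h j i) * (h k i * h k i) := by
          simp only [dotProduct, Finset.mul_sum, ← Finset.sum_add_distrib,
            ← Finset.sum_sub_distrib]
          refine Finset.sum_congr rfl fun i _ => ?_
          rcases ex j i with h | h | h <;> rcases ex k i with h' | h' | h' <;> rw [h, h'] <;>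
            norm_num
        rw [h2, he, h4, h4]
        norm_num
      rw [Finset.sum_eq_zero_iff_of_nonneg fun i _ => mul_self_nonneg _] at h1
      refine hne (funext fun i => ?_)
      have h3 := mul_self_eq_zero.1 (h1 i (Finset.mem_univ i))
      rw [reduceTwo_apply, reduceTwo_apply, ← sub_eq_zero, ← Int.cast_sub,
        intCast_zmod_two_eq_zero_iff]
      rcases ex j i with h | h | h <;> rcases ex k i with h' | h' | h' <;> rw [h, h'] at h3 ⊢ <;>
        omega
    rw [dotProduct] at h0
    rw [h4] at hle
    omega
  obtain ⟨γ, hγ, hγ4, hγj, hγk, hred⟩ := exists_reflection_vector (hh.mem_coordB j)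
    (hh.mem_coordB k) (h4 j) (h4 k) h0 hmeet
  choose a ha using fun t => hC.two_dvd_dotProduct hγ.1 (hh.mem_coordB t).1
  refine ⟨fun t => h t - a t • γ, hh.reflect hC hγ hγ4 ha, ?_, ?_⟩
  · intro t t' htt
    obtain ⟨w, hw⟩ := reduceTwo_eq_iff.1 htt
    have hww : ∀ l, 2 * (h l ⬝ᵥ w) = h l ⬝ᵥ h t - h l ⬝ᵥ h t' := fun l => by
      rw [hw, dotProduct_add, dotProduct_smul, nsmul_eq_mul]
      push_cast
      ring
    -- `2 (h l ⬝ᵥ w)` is a difference of frame products, hence divisible by 4. As `γ ≡ h j + h k`,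
    -- also `γ ⬝ᵥ w` is even, so `a t` and `a t'` have the same parity.
    have hlw : ∀ l, 2 ∣ h l ⬝ᵥ w := fun l => by
      have := hww l
      rw [hh.dotProduct_eq, hh.dotProduct_eq] at this
      split_ifs at this <;> omega
    have hγw : 2 ∣ γ ⬝ᵥ w := by
      rw [← map_add] at hred
      obtain ⟨v, hv⟩ := reduceTwo_eq_iff.1 hred
      rw [hv, add_dotProduct, add_dotProduct, smul_dotProduct, nsmul_eq_mul]
      exact dvd_add (dvd_add (hlw j) (hlw k)) (dvd_mul_right _ _)
    obtain ⟨b, hb⟩ := hγw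
    have hat : a t = a t' + 2 * b := by
      have h1 := ha t
      rw [hw, dotProduct_add, dotProduct_smul, nsmul_eq_mul, hb, ha] at h1
      push_cast at h1
      linarith
    refine reduceTwo_eq_iff.2 ⟨w - b • γ, ?_⟩
    dsimp only
    rw [hat, hw]
    module
  · have haj : a j = 0 := by have := ha j; omega
    have hak : a k = 1 := by have := ha k; omega
    dsimp only
    rw [haj, hak, zero_smul, sub_zero, one_smul, map_sub, hred, sub_add_eq_sub_sub_swap, sub_self,
      zero_sub]
    funext i
    exact (ZMod.neg_eq_self_mod_two _).symm

/-- After reflections, any two vectors of the frame have equal or disjoint supports. -/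
theorem IsGlueFrame.exists_block {ι κ : Type} [Fintype ι] [Fintype κ] [DecidableEq κ]
    {C : BinaryCode ι} (hC : C.IsDoublyEven) {D : BinaryCode κ} {h : κ → ι → ℤ}
    (hh : IsGlueFrame C D h) :
    ∃ h', IsGlueFrame C D h' ∧
      ∀ j k i, h' j i * h' k i ≠ 0 → reduceTwo (h' j) = reduceTwo (h' k) := by
  classical
  let P : (κ → ι → ℤ) → Finset (κ × κ) := fun h =>
    Finset.univ.filter fun p => reduceTwo (h p.1) = reduceTwo (h p.2)
  let S : Set ℕ := {N | ∃ h, IsGlueFrame C D h ∧ (P h).card = N}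
  have hbdd : BddAbove S := ⟨Fintype.card (κ × κ), by
    rintro _ ⟨h, -, rfl⟩
    exact Finset.card_le_univ _⟩
  obtain ⟨h', hh', hcard⟩ := Nat.sSup_mem (s := S) ⟨_, h, hh, rfl⟩ hbdd
  refine ⟨h', hh', fun j k i hi => ?_⟩
  by_contra hne
  obtain ⟨h'', hh'', hkeep, hnew⟩ := hh'.exists_merge hC hne hi
  have hlt : (P h').card < (P h'').card := by
    refine Finset.card_lt_card ⟨fun p hp => ?_, fun hsub => ?_⟩
    · simp only [P, Finset.mem_filter, Finset.mem_univ, true_and] at hp ⊢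
      exact hkeep _ _ hp
    · have h1 : (j, k) ∈ P h'' := by simpa [P] using hnew
      have h2 := hsub h1
      simp only [P, Finset.mem_filter, Finset.mem_univ, true_and] at h2
      exact hne h2
  have hle := le_csSup hbdd (show (P h'').card ∈ S from ⟨h'', hh'', rfl⟩)
  omega

/-! The standard frame. -/

/-- The coordinates of a Kleinian word read off from a binary word: the inverse of `kleinHat`
modulo the all-ones word of each block. -/
def blockKlein {m : ℕ} (z : Fin m × Fin 4 → ZMod 2) : Fin m → Klein :=
  fun i => (z (i, 1) + z (i, 3), z (i, 2) + z (i, 3))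

/-- The word has even weight on each block. -/
def BlockEven {m : ℕ} (z : Fin m × Fin 4 → ZMod 2) : Prop :=
  ∀ i, z (i, 0) + z (i, 1) + z (i, 2) + z (i, 3) = 0

/-- The word which is constant on each block. -/
def blockConst {m : ℕ} (t : Fin m → ZMod 2) : Fin m × Fin 4 → ZMod 2 := fun p => t p.1

/-- `kleinHat` vanishes at position 3, so that entry is the constant part on the block. -/
theorem BlockEven.eq_add {m : ℕ} {z : Fin m × Fin 4 → ZMod 2} (hz : BlockEven z) :
    z = kleinHatHom m (blockKlein z) + blockConst fun i => z (i, 3) := by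
  have key : ∀ a b c d : ZMod 2, a + b + c + d = 0 →
      ![a, b, c, d] = fun j => kleinHat (b + d, c + d) j + d := by decide
  funext ⟨i, j⟩
  have := congrFun (key _ _ _ _ (hz i)) j
  have h2 : z (i, j) = ![z (i, 0), z (i, 1), z (i, 2), z (i, 3)] j := by
    fin_cases j <;> rfl
  rw [h2, this]
  rfl

theorem blockEven_hat_add {m : ℕ} (k : Fin m → Klein) (t : Fin m → ZMod 2) :
    BlockEven (kleinHatHom m k + blockConst t) := by
  intro i
  have key : ∀ (k : Klein) (t : ZMod 2),
      (kleinHat k 0 + t) + (kleinHat k 1 + t) + (kleinHat k 2 + t) + (kleinHat k 3 + t) = 0 := by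
    decide
  exact key _ _

theorem blockKlein_hat_add {m : ℕ} (k : Fin m → Klein) (t : Fin m → ZMod 2) :
    blockKlein (kleinHatHom m k + blockConst t) = k := by
  funext i
  have key : ∀ (k : Klein) (t : ZMod 2),
      ((kleinHat k 1 + t) + (kleinHat k 3 + t), (kleinHat k 2 + t) + (kleinHat k 3 + t)) = k := by
    decide
  exact key _ _

theorem hat_add_apply_three {m : ℕ} (k : Fin m → Klein) (t : Fin m → ZMod 2) (i : Fin m) :
    (kleinHatHom m k + blockConst t) (i, 3) = t i := by
  have key : ∀ (k : Klein) (t : ZMod 2), kleinHat k 3 + t = t := by decide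
  exact key (k i) _

theorem blockConst_mem_d4Pow {m : ℕ} (t : Fin m → ZMod 2) : blockConst t ∈ d4Pow m :=
  fun _ _ _ => rfl

theorem eq_blockConst_of_mem_d4Pow {m : ℕ} {v : Fin m × Fin 4 → ZMod 2} (hv : v ∈ d4Pow m) :
    v = blockConst fun i => v (i, 3) :=
  funext fun p => hv p.1 p.2 3

theorem blockConst_mem_d4PowZero {m : ℕ} {t : Fin m → ZMod 2} (ht : ∑ i, t i = 0) :
    blockConst t ∈ d4PowZero m :=
  ⟨blockConst_mem_d4Pow t, (d4Pow_dvd_iff (blockConst_mem_d4Pow t)).2 ht⟩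

theorem KleinianCode.mem_hat {m : ℕ} {K : KleinianCode m} {z : Fin m × Fin 4 → ZMod 2} :
    z ∈ K.hat ↔ ∃ k ∈ K, kleinHatHom m k = z := Iff.rfl

theorem KleinianCode.mem_codeA {m : ℕ} {K : KleinianCode m} {z : Fin m × Fin 4 → ZMod 2} :
    z ∈ K.codeA ↔ BlockEven z ∧ blockKlein z ∈ K := by
  rw [KleinianCode.codeA, Submodule.mem_sup]
  constructor
  · rintro ⟨_, ⟨k, hk, rfl⟩, v, hv, rfl⟩
    rw [eq_blockConst_of_mem_d4Pow hv]
    refine ⟨blockEven_hat_add _ _, ?_⟩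
    rwa [blockKlein_hat_add]
  · rintro ⟨hz, hk⟩
    exact ⟨_, KleinianCode.mem_hat.2 ⟨_, hk, rfl⟩, _, blockConst_mem_d4Pow _, hz.eq_add.symm⟩

theorem KleinianCode.mem_codeB {m : ℕ} {K : KleinianCode m} {z : Fin m × Fin 4 → ZMod 2} :
    z ∈ K.codeB ↔ (BlockEven z ∧ blockKlein z ∈ K) ∧ ∑ i, z (i, 3) = 0 := by
  rw [KleinianCode.codeB, Submodule.mem_sup]
  constructor
  · rintro ⟨_, ⟨k, hk, rfl⟩, v, hv, rfl⟩
    have h0 := (d4Pow_dvd_iff hv.1).1 hv.2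
    rw [eq_blockConst_of_mem_d4Pow hv.1]
    refine ⟨⟨blockEven_hat_add _ _, by rwa [blockKlein_hat_add]⟩, ?_⟩
    simp only [hat_add_apply_three]
    rw [← h0]
    exact Finset.sum_congr rfl fun i _ => hv.1 i 3 0
  · rintro ⟨⟨hz, hk⟩, hs⟩
    exact ⟨_, KleinianCode.mem_hat.2 ⟨_, hk, rfl⟩, _, blockConst_mem_d4PowZero hs, hz.eq_add.symm⟩

/-- The `4 × 4` Hadamard matrix with the all-ones vector as last column. -/
def hadamardFour : Fin 4 → Fin 4 → ℤ :=
  ![![1, -1, -1, 1], ![1, -1, 1, -1], ![1, 1, -1, -1], ![1, 1, 1, 1]]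

/-- The block-diagonal frame built from `hadamardFour`, indexed by blocks and columns. -/
def hadamardFrame (m : ℕ) (q p : Fin m × Fin 4) : ℤ :=
  if p.1 = q.1 then hadamardFour q.2 p.2 else 0

theorem sum_smul_hadamardFrame_apply {m : ℕ} (y : Fin m × Fin 4 → ℤ) (p : Fin m × Fin 4) :
    (∑ q, y q • hadamardFrame m q) p = ∑ r, y (p.1, r) * hadamardFour r p.2 := by
  rw [Finset.sum_apply, Fintype.sum_prod_type, Finset.sum_eq_single p.1]
  · simp [hadamardFrame]
  · intro b _ hb
    simp [hadamardFrame, hb.symm]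
  · simp

theorem sum_smul_hadamardFrame_eq_iff {m : ℕ} (y x : Fin m × Fin 4 → ℤ) :
    ∑ q, y q • hadamardFrame m q = 2 • x ↔ ∀ i,
      y (i, 0) + y (i, 1) + y (i, 2) + y (i, 3) = 2 * x (i, 0) ∧
      -y (i, 0) - y (i, 1) + y (i, 2) + y (i, 3) = 2 * x (i, 1) ∧
      -y (i, 0) + y (i, 1) - y (i, 2) + y (i, 3) = 2 * x (i, 2) ∧
      y (i, 0) - y (i, 1) - y (i, 2) + y (i, 3) = 2 * x (i, 3) := by
  rw [funext_iff, Prod.forall]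
  refine forall_congr' fun i => ?_
  rw [Fin.forall_fin_succ, Fin.forall_fin_succ, Fin.forall_fin_succ, Fin.forall_fin_one]
  simp only [sum_smul_hadamardFrame_apply, Fin.sum_univ_four]
  have h2 : ∀ p, (2 • x) p = 2 * x p := fun p => by
    change 2 • x p = _
    rw [two_nsmul, two_mul]
  simp only [h2]
  refine and_congr ?_ (and_congr ?_ (and_congr ?_ ?_)) <;>
  · simp [hadamardFour, sub_eq_add_neg]

theorem hadamardFrame_dotProduct {m : ℕ} (q q' : Fin m × Fin 4) :
    hadamardFrame m q ⬝ᵥ hadamardFrame m q' = if q = q' then 4 else 0 := by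
  have key : ∀ a b : Fin 4, ∑ r, hadamardFour a r * hadamardFour b r = if a = b then 4 else 0 := by
    decide
  rw [dotProduct, Fintype.sum_prod_type, Finset.sum_eq_single q.1]
  · by_cases h : q.1 = q'.1
    · simp [hadamardFrame, h, key, Prod.ext_iff]
    · simp [hadamardFrame, h, Prod.ext_iff]
  · intro b _ hb
    simp [hadamardFrame, hb]
  · simp

theorem even_block_iff {m : ℕ} (x : Fin m × Fin 4 → ℤ) :
    BlockEven (reduceTwo x) ↔
      ∀ i, 2 ∣ x (i, 0) + x (i, 1) + x (i, 2) + x (i, 3) := by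
  refine forall_congr' fun i => ?_
  rw [← intCast_zmod_two_eq_zero_iff]
  simp

/-- On each block `∑ x = 2 y₃`, `x₁ + x₃ = y₃ - y₁` and `x₂ + x₃ = y₃ - y₂`. So the Klein words
agree, and `4 ∣ ∑ x` says that the sum of the `y₃` is even. -/
theorem mem_codeB_iff_of_hadamard {m : ℕ} (K : KleinianCode m) {x y : Fin m × Fin 4 → ℤ}
    (h : ∑ q, y q • hadamardFrame m q = 2 • x) :
    reduceTwo y ∈ K.codeB ↔ x ∈ K.codeA.coordB := by
  rw [sum_smul_hadamardFrame_eq_iff] at h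
  rw [KleinianCode.mem_codeB, BinaryCode.mem_coordB, KleinianCode.mem_codeA]
  have hy : BlockEven (reduceTwo y) := (even_block_iff y).2 fun i => ⟨_, (h i).1⟩
  have hx : BlockEven (reduceTwo x) := (even_block_iff x).2 fun i => by
    obtain ⟨h0, h1, h2, h3⟩ := h i
    exact ⟨y (i, 3), by linarith⟩
  have hk : blockKlein (reduceTwo x) = blockKlein (reduceTwo y) := by
    funext i
    obtain ⟨h0, h1, h2, h3⟩ := h i
    simp only [blockKlein, reduceTwo_apply, ← Int.cast_add]
    refine Prod.ext ?_ ?_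
    · dsimp only
      rw [← sub_eq_zero, ← Int.cast_sub, intCast_zmod_two_eq_zero_iff]
      exact ⟨-y (i, 1), by linarith⟩
    · dsimp only
      rw [← sub_eq_zero, ← Int.cast_sub, intCast_zmod_two_eq_zero_iff]
      exact ⟨-y (i, 2), by linarith⟩
  have hs : ∑ p, x p = 2 * ∑ i, y (i, 3) := by
    rw [Fintype.sum_prod_type, Finset.mul_sum]
    refine Finset.sum_congr rfl fun i _ => ?_
    obtain ⟨h0, h1, h2, h3⟩ := h i
    rw [Fin.sum_univ_four]
    linarith
  have hs' : (∑ i, reduceTwo y (i, 3) = 0) ↔ 4 ∣ ∑ p, x p := by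
    simp only [reduceTwo_apply]
    rw [← Int.cast_sum, intCast_zmod_two_eq_zero_iff, hs]
    omega
  rw [hk, hs']
  exact and_congr (and_congr (iff_of_true hy hx) Iff.rfl) Iff.rfl

theorem exists_hadamard_of_mem_codeB {m : ℕ} {K : KleinianCode m} {y : Fin m × Fin 4 → ℤ}
    (hy : reduceTwo y ∈ K.codeB) : ∃ x : Fin m × Fin 4 → ℤ, ∑ q, y q • hadamardFrame m q = 2 • x := by
  have h := (even_block_iff y).1 (KleinianCode.mem_codeB.1 hy).1.1
  have h2 : ∀ p : Fin m × Fin 4, ∃ a, ∑ r, y (p.1, r) * hadamardFour r p.2 = 2 * a := by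
    rintro ⟨i, j⟩
    obtain ⟨s, hs⟩ := h i
    rw [Fin.sum_univ_four]
    fin_cases j
    · exact ⟨s, by simp [hadamardFour]; linarith⟩
    · exact ⟨s - y (i, 0) - y (i, 1), by simp [hadamardFour]; linarith⟩
    · exact ⟨s - y (i, 0) - y (i, 2), by simp [hadamardFour]; linarith⟩
    · exact ⟨s - y (i, 1) - y (i, 2), by simp [hadamardFour]; linarith⟩
  choose x hx using h2
  refine ⟨x, funext fun p => ?_⟩
  rw [sum_smul_hadamardFrame_apply, hx]
  change _ = 2 • x p
  rw [two_nsmul, two_mul]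

theorem exists_hadamard_eq {m : ℕ} {K : KleinianCode m} {x : Fin m × Fin 4 → ℤ}
    (hx : x ∈ K.codeA.coordB) : ∃ y : Fin m × Fin 4 → ℤ, ∑ q, y q • hadamardFrame m q = 2 • x := by
  have h := (even_block_iff x).1 (KleinianCode.mem_codeA.1 hx.1).1
  choose s hs using h
  -- Half the Hadamard matrix is orthogonal, so its transpose inverts it; `s` is half the block sum
  -- of `x`.
  let y : Fin m × Fin 4 → ℤ := fun p =>
    ![s p.1 - x (p.1, 1) - x (p.1, 2), s p.1 - x (p.1, 1) - x (p.1, 3),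
      s p.1 - x (p.1, 2) - x (p.1, 3), s p.1] p.2
  refine ⟨y, (sum_smul_hadamardFrame_eq_iff y x).2 fun i => ?_⟩
  have e0 : y (i, 0) = s i - x (i, 1) - x (i, 2) := rfl
  have e1 : y (i, 1) = s i - x (i, 1) - x (i, 3) := rfl
  have e2 : y (i, 2) = s i - x (i, 2) - x (i, 3) := rfl
  have e3 : y (i, 3) = s i := rfl
  have := hs i
  rw [e0, e1, e2, e3]
  refine ⟨?_, ?_, ?_, ?_⟩ <;> linarith

/-! Frames carried by blocks of four coordinates. -/

theorem exists_equiv_prod_fin_of_card_fiber {ι β : Type} [Fintype ι] [DecidableEq β] (f : ι → β)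
    (r : ℕ) (hf : ∀ i, Fintype.card {i' // f i' = f i} = r) :
    ∃ (m : ℕ) (σ : ι ≃ Fin m × Fin r), ∀ i i', f i = f i' ↔ (σ i).1 = (σ i').1 := by
  classical
  let g : ι → Set.range f := Set.rangeFactorization f
  have hg : ∀ b : Set.range f, Nonempty ({i // g i = b} ≃ Fin r) := by
    rintro ⟨_, i, rfl⟩
    refine Fintype.card_eq.1 ?_
    rw [Fintype.card_fin, ← hf i]
    exact Fintype.card_congr (Equiv.subtypeEquivRight fun i' => Subtype.ext_iff)
  let e := fun b => (hg b).some
  let E := Finite.equivFin (Set.range f)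
  refine ⟨_, (Equiv.sigmaFiberEquiv g).symm.trans ((Equiv.sigmaCongrRight e).trans
    ((Equiv.sigmaEquivProd _ _).trans (E.prodCongr (Equiv.refl _)))), fun i i' => ?_⟩
  change _ ↔ E (g i) = E (g i')
  rw [E.apply_eq_iff_eq]
  exact (Subtype.ext_iff (a1 := g i) (a2 := g i')).symm

/-- The sum condition means an even number of minus signs; these eight vectors are the rows of
`hadamardFour` and their negatives. -/
theorem exists_eq_mul_hadamardFour {s : Fin 4 → ℤ} (hs : ∀ r, s r = 1 ∨ s r = -1)
    (h4 : 4 ∣ ∑ r, s r) :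
    ∃ (q : Fin 4) (ε : ℤ), (ε = 1 ∨ ε = -1) ∧ ∀ r, s r = ε * hadamardFour q r := by
  have key : ∀ b : Fin 4 → Bool, 4 ∣ ∑ r, (if b r then (1 : ℤ) else -1) →
      ∃ (q : Fin 4) (e : Bool), ∀ r,
        (if b r then (1 : ℤ) else -1) = (if e then 1 else -1) * hadamardFour q r := by
    decide
  have hb : ∀ r, s r = if decide (s r = 1) then (1 : ℤ) else -1 := fun r => by
    rcases hs r with h | h <;> rw [h] <;> rfl
  obtain ⟨q, e, he⟩ := key (fun r => decide (s r = 1)) (by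
    rw [← Finset.sum_congr rfl fun r _ => hb r]
    exact h4)
  refine ⟨q, if e then 1 else -1, by cases e <;> simp, fun r => ?_⟩
  rw [hb r]
  exact he r

theorem IsGlueFrame.exists_hadamard {ι : Type} [Fintype ι] [DecidableEq ι]
    {C D : BinaryCode ι} {h : ι → ι → ℤ} (hh : IsGlueFrame C D h)
    (hblock : ∀ j k i, h j i * h k i ≠ 0 → reduceTwo (h j) = reduceTwo (h k)) :
    ∃ (m : ℕ) (σ τ : ι ≃ Fin m × Fin 4) (ε : ι → ℤ), (∀ j, ε j = 1 ∨ ε j = -1) ∧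
      ∀ j i, h j i = ε j * hadamardFrame m (τ j) (σ i) := by
  classical
  have h4 : ∀ t, h t ⬝ᵥ h t = 4 := fun t => by rw [hh.dotProduct_eq, if_pos rfl]
  have ex : ∀ t i, h t i = 0 ∨ h t i = 1 ∨ h t i = -1 := fun t =>
    entry_eq_zero_or_of_norm_four (h4 t) (hh.mem_coordB t).2
  have hred : ∀ t i, h t i ≠ 0 ↔ reduceTwo (h t) i ≠ 0 := fun t i => by
    rw [reduceTwo_apply, Ne, Ne, intCast_zmod_two_eq_zero_iff]
    rcases ex t i with h | h | h <;> rw [h] <;> norm_num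
  have hcol : ∀ i, ∃ j, h j i ≠ 0 := fun i => by
    by_contra! hcon
    have := sum_sq_eq_four_of_orthogonal hh.dotProduct_eq i
    simp [hcon] at this
  have hrow : ∀ j, ∃ i, h j i ≠ 0 := fun j => by
    by_contra! hcon
    have := h4 j
    simp [dotProduct, hcon] at this
  choose c hc using hcol
  choose r hr using hrow
  have hcard : ∀ j, Fintype.card {i // h j i ≠ 0} = 4 := fun j => by
    have h1 : (Fintype.card {i // h j i ≠ 0} : ℤ) = h j ⬝ᵥ h j := by
      rw [Fintype.card_subtype, Finset.card_filter, Nat.cast_sum]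
      refine Finset.sum_congr rfl fun i _ => ?_
      rcases ex j i with h | h | h <;> rw [h] <;> norm_num
    rw [h4] at h1
    exact_mod_cast h1
  -- All frame vectors through a coordinate `i` share one support, so the reduction of `h (c i)`
  -- labels the block of `i`.
  have hf : ∀ j i, reduceTwo (h (c i)) = reduceTwo (h j) ↔ h j i ≠ 0 := fun j i => by
    constructor
    · intro he
      rw [hred, ← he, ← hred]
      exact hc i
    · exact fun hi => hblock _ _ i (mul_ne_zero (hc i) hi)
  obtain ⟨m, σ, hσ⟩ := exists_equiv_prod_fin_of_card_fiber (fun i => reduceTwo (h (c i))) 4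
    fun i => by
      rw [← hcard (c i)]
      exact Fintype.card_congr (Equiv.subtypeEquivRight fun i' => hf _ _)
  have hsupp : ∀ j i, h j i ≠ 0 ↔ (σ i).1 = (σ (r j)).1 := fun j i => by
    rw [← hσ, ← hf j i, (hf j (r j)).2 (hr j)]
  have hsign : ∀ j, ∃ (q : Fin 4) (ε : ℤ), (ε = 1 ∨ ε = -1) ∧
      ∀ s, h j (σ.symm ((σ (r j)).1, s)) = ε * hadamardFour q s := fun j => by
    refine exists_eq_mul_hadamardFour (fun s => ?_) ?_
    · refine (ex j _).resolve_left ?_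
      rw [← Ne, hsupp, σ.apply_symm_apply]
    · have h1 : ∑ i, h j i = ∑ s, h j (σ.symm ((σ (r j)).1, s)) := by
        rw [← σ.symm.sum_comp, Fintype.sum_prod_type, Finset.sum_eq_single (σ (r j)).1]
        · intro b _ hb
          refine Finset.sum_eq_zero fun s _ => ?_
          by_contra hne
          rw [← Ne, hsupp, σ.apply_symm_apply] at hne
          exact hb hne
        · simp
      rw [← h1]
      exact (hh.mem_coordB j).2
  choose q ε hε hq using hsign
  let τ : ι → Fin m × Fin 4 := fun j => ((σ (r j)).1, q j)
  have hform : ∀ j i, h j i = ε j * hadamardFrame m (τ j) (σ i) := fun j i => by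
    by_cases hi : (σ i).1 = (σ (r j)).1
    · rw [hadamardFrame, if_pos hi, ← hq, ← hi, Prod.mk.eta, σ.symm_apply_apply]
    · rw [hadamardFrame, if_neg hi, mul_zero]
      by_contra hne
      exact hi ((hsupp j i).1 hne)
  -- Equal block and equal row would make the two vectors proportional, against orthogonality.
  have hinj : Function.Injective τ := fun j k hjk => by
    by_contra hne
    have h1 : h j ⬝ᵥ h k = ε j * ε k * (hadamardFrame m (τ k) ⬝ᵥ hadamardFrame m (τ k)) := by
      rw [dotProduct, dotProduct, ← σ.sum_comp, Finset.mul_sum]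
      refine Finset.sum_congr rfl fun i _ => ?_
      rw [hform j, hform k, hjk]
      ring
    rw [hh.dotProduct_eq, if_neg hne, hadamardFrame_dotProduct, if_pos rfl] at h1
    rcases hε j with h | h <;> rcases hε k with h' | h' <;> rw [h, h'] at h1 <;> norm_num at h1
  have hbij : Function.Bijective τ :=
    (Fintype.bijective_iff_injective_and_card τ).2 ⟨hinj, Fintype.card_congr σ⟩
  exact ⟨m, σ, Equiv.ofBijective τ hbij, ε, hε, hform⟩

/-! ### Standard frames and the codes they determine. -/

theorem mem_coordB_comp_iff {ι κ : Type} [Fintype ι] [Fintype κ] {C : BinaryCode ι}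
    {C' : BinaryCode κ} {σ : ι ≃ κ} (hσ : ∀ z, z ∈ C' ↔ z ∘ σ ∈ C) (x : κ → ℤ) :
    x ∈ C'.coordB ↔ x ∘ σ ∈ C.coordB := by
  rw [BinaryCode.mem_coordB, BinaryCode.mem_coordB, hσ]
  refine and_congr Iff.rfl ?_
  rw [← σ.sum_comp]
  rfl

/-- This has the shape of `IsGlueFrame.mem_iff`: once `C` is `𝒞(K)`, the standard frame forces the
second code to be `𝒞⁺(K)`. -/
theorem mem_codeB_iff_exists {ι : Type} [Fintype ι] {C : BinaryCode ι} {m : ℕ}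
    {K : KleinianCode m} {σ : ι ≃ Fin m × Fin 4} (hσ : ∀ z, z ∈ K.codeA ↔ z ∘ σ ∈ C)
    (y : Fin m × Fin 4 → ℤ) :
    reduceTwo y ∈ K.codeB ↔
      ∃ x ∈ C.coordB, (∑ q, y q • hadamardFrame m q) ∘ σ = 2 • x := by
  constructor
  · intro hy
    obtain ⟨x, hx⟩ := exists_hadamard_of_mem_codeB hy
    refine ⟨x ∘ σ, (mem_coordB_comp_iff hσ x).1 ((mem_codeB_iff_of_hadamard K hx).1 hy), ?_⟩
    rw [hx]
    rfl
  · rintro ⟨x, hx, hxy⟩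
    have h1 : ∑ q, y q • hadamardFrame m q = 2 • (x ∘ σ.symm) := by
      funext p
      have := congrFun hxy (σ.symm p)
      rwa [Function.comp_apply, σ.apply_symm_apply] at this
    rw [mem_codeB_iff_of_hadamard K h1, mem_coordB_comp_iff hσ]
    convert hx
    funext i
    simp

theorem sum_smul_hadamardFrame_comp {ι : Type} [Fintype ι] {m : ℕ}
    (σ τ : ι ≃ Fin m × Fin 4) (y : Fin m × Fin 4 → ℤ) :
    (∑ q, y q • hadamardFrame m q) ∘ σ = ∑ j, y (τ j) • (hadamardFrame m (τ j) ∘ σ) := by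
  rw [← τ.sum_comp]
  funext i
  simp [Finset.sum_apply]

theorem isGlueFrame_hadamard {ι : Type} [Fintype ι] [DecidableEq ι] {C D : BinaryCode ι} {m : ℕ}
    {K : KleinianCode m} {σ τ : ι ≃ Fin m × Fin 4} (hσ : ∀ z, z ∈ K.codeA ↔ z ∘ σ ∈ C)
    (hτ : ∀ z, z ∈ K.codeB ↔ z ∘ τ ∈ D) :
    IsGlueFrame C D fun j => hadamardFrame m (τ j) ∘ σ := by
  refine ⟨fun j k => ?_, fun y => ?_⟩
  · rw [show (hadamardFrame m (τ j) ∘ σ) ⬝ᵥ (hadamardFrame m (τ k) ∘ σ) =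
      hadamardFrame m (τ j) ⬝ᵥ hadamardFrame m (τ k) from
        σ.sum_comp fun p => hadamardFrame m (τ j) p * hadamardFrame m (τ k) p,
      hadamardFrame_dotProduct]
    simp only [τ.apply_eq_iff_eq]
  · have h1 := mem_codeB_iff_exists hσ (y ∘ τ.symm)
    rw [sum_smul_hadamardFrame_comp σ τ, hτ] at h1
    have h2 : reduceTwo (y ∘ τ.symm) ∘ τ = reduceTwo y := by
      funext j
      simp
    simpa only [h2, Function.comp_apply, τ.symm_apply_apply] using h1

theorem exists_sum_hadamard_eq {ι : Type} [Fintype ι] {C : BinaryCode ι} {m : ℕ}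
    {K : KleinianCode m} {σ τ : ι ≃ Fin m × Fin 4} (hσ : ∀ z, z ∈ K.codeA ↔ z ∘ σ ∈ C)
    {x : ι → ℤ} (hx : x ∈ C.coordB) :
    ∃ y : ι → ℤ, ∑ j, y j • (hadamardFrame m (τ j) ∘ σ) = 2 • x := by
  have h0 : (x ∘ σ.symm) ∘ σ = x := by
    funext i
    simp
  obtain ⟨y, hy⟩ := exists_hadamard_eq ((mem_coordB_comp_iff hσ (x ∘ σ.symm)).2 (by rwa [h0]))
  refine ⟨y ∘ τ, ?_⟩
  have h1 := sum_smul_hadamardFrame_comp σ τ y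
  rw [hy] at h1
  rw [← h0]
  exact h1.symm

/-! ### Recovering the Kleinian code. -/

/-- The Kleinian code of the words whose binary image, read along `σ`, lies in `C`. -/
def BinaryCode.kleinian {ι : Type} {m : ℕ} (C : BinaryCode ι) (σ : ι ≃ Fin m × Fin 4) :
    KleinianCode m where
  carrier := {k | kleinHatHom m k ∘ σ ∈ C}
  zero_mem' := by
    change kleinHatHom m 0 ∘ σ ∈ C
    rw [map_zero]
    exact C.zero_mem
  add_mem' {k l} hk hl := by
    change kleinHatHom m (k + l) ∘ σ ∈ C
    rw [map_add]
    exact C.add_mem hk hl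
  neg_mem' {k} hk := by
    change kleinHatHom m (-k) ∘ σ ∈ C
    rw [map_neg]
    exact C.neg_mem hk

theorem hammingNorm_kleinHatHom {m : ℕ} (k : Fin m → Klein) :
    hammingNorm (kleinHatHom m k) = 2 * hammingNorm k := by
  have key : ∀ k : Klein, ∑ r, (kleinHat k r).val = 2 * if k ≠ 0 then 1 else 0 := by decide
  rw [← sum_val_eq_hammingNorm, Fintype.sum_prod_type, hammingNorm, Finset.card_filter,
    Finset.mul_sum]
  exact Finset.sum_congr rfl fun i _ => key (k i)

theorem BinaryCode.IsDoublyEven.isEven_kleinian {ι : Type} [Fintype ι] {C : BinaryCode ι}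
    (hC : C.IsDoublyEven) {m : ℕ} (σ : ι ≃ Fin m × Fin 4) : (C.kleinian σ).IsEven := by
  intro k hk
  have h1 := hC _ hk
  have h2 : hammingNorm (kleinHatHom m k ∘ σ) = hammingNorm (kleinHatHom m k) := by
    rw [← sum_val_eq_hammingNorm, ← sum_val_eq_hammingNorm]
    exact σ.sum_comp fun p => (kleinHatHom m k p).val
  rw [h2, hammingNorm_kleinHatHom] at h1
  omega

/-- A doubly-even code that contains the all-ones words of the blocks is of the form `𝒞(K)`. -/
theorem BinaryCode.IsDoublyEven.mem_codeA_kleinian_iff {ι : Type} [Fintype ι] {C : BinaryCode ι}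
    (hC : C.IsDoublyEven) {m : ℕ} {σ : ι ≃ Fin m × Fin 4}
    (hblock : ∀ b, blockConst (Pi.single b 1) ∘ σ ∈ C) (z : Fin m × Fin 4 → ZMod 2) :
    z ∈ (C.kleinian σ).codeA ↔ z ∘ σ ∈ C := by
  have hconst : ∀ t : Fin m → ZMod 2, blockConst t ∘ σ ∈ C := fun t => by
    have h1 : blockConst t ∘ σ = ∑ b, t b • (blockConst (Pi.single b 1) ∘ σ) := by
      funext i
      simp [blockConst, Finset.sum_apply, Pi.single_apply]
    rw [h1]
    exact C.sum_mem fun b _ => C.smul_mem _ (hblock b)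
  have hsplit : BlockEven z → (z ∘ σ ∈ C ↔ blockKlein z ∈ C.kleinian σ) := fun hz => by
    have h1 : z ∘ σ = kleinHatHom m (blockKlein z) ∘ σ +
        blockConst (fun i => z (i, 3)) ∘ σ := by
      conv_lhs => rw [hz.eq_add]
      rfl
    rw [h1, C.add_mem_iff_left (hconst _)]
    rfl
  rw [KleinianCode.mem_codeA]
  constructor
  · rintro ⟨hz, hk⟩
    exact (hsplit hz).2 hk
  · intro hz
    -- Evenness on block `b` is orthogonality to the all-ones word of that block.
    have hE : BlockEven z := fun b => by
      have h1 := hC.sum_mul_eq_zero hz (hblock b)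
      rw [show (∑ i, (z ∘ σ) i * (blockConst (Pi.single b 1) ∘ σ) i) =
        ∑ p, z p * blockConst (Pi.single b 1) p from
          σ.sum_comp fun p => z p * blockConst (Pi.single b 1) p,
        Fintype.sum_prod_type, Finset.sum_eq_single b] at h1
      · simpa [blockConst, Fin.sum_univ_four] using h1
      · intro b' _ hb'
        simp [blockConst, hb']
      · simp
    exact ⟨hE, (hsplit hE).1 hz⟩

theorem IsGlueFrame.exists_kleinian {ι : Type} [Fintype ι] [DecidableEq ι] {C D : BinaryCode ι}
    (hC : C.IsDoublyEven) {h : ι → ι → ℤ} (hh : IsGlueFrame C D h) :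
    ∃ (m : ℕ) (K : KleinianCode m), K.IsEven ∧
      C.IsEquivalent K.codeA ∧ D.IsEquivalent K.codeB := by
  obtain ⟨h, hh, hblock⟩ := hh.exists_block hC
  obtain ⟨m, σ, τ, ε, hε, hform⟩ := hh.exists_hadamard hblock
  have hεε : ∀ j, ε j * ε j = 1 := fun j => by
    rcases hε j with h | h <;> rw [h] <;> norm_num
  have hε2 : ∀ j, (ε j : ZMod 2) = 1 := fun j => by
    rcases hε j with h | h <;> rw [h]
    · norm_num
    · decide
  have hones : ∀ b, blockConst (Pi.single b 1) ∘ σ ∈ C := fun b => by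
    have h1 : blockConst (Pi.single b 1) ∘ σ = reduceTwo (h (τ.symm (b, 0))) := by
      have key : ∀ a r : Fin 4, ((hadamardFour a r : ℤ) : ZMod 2) = 1 := by decide
      funext i
      rw [reduceTwo_apply, hform, Int.cast_mul, hε2, one_mul, τ.apply_symm_apply]
      by_cases hb : (σ i).1 = b
      · simp [blockConst, hadamardFrame, hb, key]
      · simp [blockConst, hadamardFrame, hb]
    rw [h1]
    exact (hh.mem_coordB _).1
  have hσ := hC.mem_codeA_kleinian_iff hones
  refine ⟨m, C.kleinian σ, hC.isEven_kleinian σ, ⟨σ, hσ⟩, ⟨τ, fun z => ?_⟩⟩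
  have h1 := mem_codeB_iff_exists hσ (binaryLift z)
  -- Weighting by `ε j` cancels the signs of the frame and is invisible modulo 2.
  have h2 := hh.mem_iff fun j => ε j * binaryLift z (τ j)
  have h3 : reduceTwo (fun j => ε j * binaryLift z (τ j)) = z ∘ τ := by
    funext j
    simp [hε2, binaryLift]
  have h4 : ∑ j, (ε j * binaryLift z (τ j)) • h j =
      (∑ q, binaryLift z q • hadamardFrame m q) ∘ σ := by
    rw [sum_smul_hadamardFrame_comp σ τ]
    refine Finset.sum_congr rfl fun j _ => funext fun i => ?_
    rw [Pi.smul_apply, hform, Pi.smul_apply, smul_eq_mul, smul_eq_mul, Function.comp_apply]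
    linear_combination (binaryLift z (τ j) * hadamardFrame m (τ j) (σ i)) * hεε j
  rw [h3, h4] at h2
  rw [reduceTwo_binaryLift] at h1
  rw [h1, h2]

theorem theorem1p4 (n : ℕ) (C D : BinaryCode (Fin n))
    (hC : C.IsDoublyEven) (hD : D.IsDoublyEven) :
    LatticeIsomorphic C.latticeB D.latticeA ↔
      ∃ (m : ℕ) (K : KleinianCode m), K.IsEven ∧
        C.IsEquivalent K.codeA ∧ D.IsEquivalent K.codeB := by
  constructor
  · intro hiso
    obtain ⟨h, hh⟩ := exists_isGlueFrame hC hiso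
    exact hh.exists_kleinian hC
  · rintro ⟨m, K, -, ⟨σ, hσ⟩, ⟨τ, hτ⟩⟩
    exact (isGlueFrame_hadamard hσ hτ).latticeIsomorphic hC fun x hx =>
      exists_sum_hadamard_eq hσ hx
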